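/- Let $\mathbb{S}^2=\operatorname{Spec}\bigl(\mathbb{R}[x,y,z]/(x^2+y^2+z^2-1)\bigr)$, and for a real scheme or a morphism of real schemes let the subscript $\mathbb{C}$ denote its complexification, i.e. its base change along $\operatorname{Spec}\mathbb{C}\to\operatorname{Spec}\mathbb{R}$. The isomorphism $\psi$ from $\mathbb{P}^1_{\mathbb{C}}\times\mathbb{P}^1_{\mathbb{C}}$ onto the quadric $\mathbb{Q}^2_{\mathbb{C}}=\{X^2+Y^2+Z^2=T^2\}\subset\mathbb{P}^3_{\mathbb{C}}$ given by $$([x_0:x_1],[y_0:y_1])\mapsto[X:Y:Z:T]=[x_0y_1+x_1y_0: i(x_1y_0-x_0y_1): x_0y_0-x_1y_1: x_0y_0+x_1y_1]$$ identifies the affine open subset $\{x_0y_0+x_1y_1\neq 0\}$ with $\mathbb{S}^2_{\mathbb{C}}=\mathbb{Q}^2_{\mathbb{C}}\setminus\{T=0\}$. For $n\geq 0$ let $L_n$ be the restriction to $\mathbb{S}^2_{\mathbb{C}}$ of the line bundle $\mathrm{pr}_1^*\mathcal{O}_{\mathbb{P}^1_{\mathbb{C}}}(n)$, and let $\sigma$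 be the canonical real structure (complex conjugation) on $\mathbb{S}^2_{\mathbb{C}}$. The rank $2$ bundle $L_n\oplus\sigma^*L_n$, with the lift of $\sigma$ that exchanges the two summands, descends to a real algebraic vector bundle $q_n:V_n\to\mathbb{S}^2$ of rank $2$. **Lemma.** For every $n\geq 0$, the complexification $q_{n,\mathbb{C}}:V_{n,\mathbb{C}}\to\mathbb{S}^2_{\mathbb{C}}$ of $q_n$ is isomorphic, as an algebraic vector bundle over $\mathbb{S}^2_{\mathbb{C}}$, to the trivial vector bundle $\mathrm{pr}_1:\mathbb{S}^2_{\mathbb{C}}\times\mathbb{A}^2_{\mathbb{C}}\to\mathbb{S}^2_{\mathbb{C}}$. -/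

import Mathlib

open CategoryTheory CategoryTheory.Limits AlgebraicGeometry TensorProduct

noncomputable section

/-! ### Linear schemes and vector bundles over a scheme -/

/-- The morphisms `s : T ⟶ V` lying over `f : T ⟶ S`, for a scheme `q : V ⟶ S` over `S`: the
sections of the pull-back of `V` to `T`. -/
@[ext]
structure SectionsOver {V S T : Scheme.{0}} (q : V ⟶ S) (f : T ⟶ S) where
  hom : T ⟶ V
  comm : hom ≫ q = f

namespace SectionsOver

variable {V W S T T' : Scheme.{0}} {q : V ⟶ S} {p : W ⟶ S} {f : T ⟶ S}

/-- Restriction of a section along `h : T' ⟶ T`. -/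
def restrict (h : T' ⟶ T) (s : SectionsOver q f) : SectionsOver q (h ≫ f) :=
  ⟨h ≫ s.hom, by rw [Category.assoc, s.comm]⟩

/-- Composition of a section with an `S`-morphism. -/
def map (e : V ⟶ W) (he : e ≫ p = q) (s : SectionsOver q f) : SectionsOver p f :=
  ⟨s.hom ≫ e, by rw [Category.assoc, he, s.comm]⟩

end SectionsOver

/-- A scheme in `𝒪_S`-modules (the linear structure that a geometric vector bundle over `S`
carries): a scheme `proj : total ⟶ S` such that, for every `f : T ⟶ S`, the sections of its
pull-back to `T` form a `Γ(T, 𝒪_T)`-module, compatibly with restriction along all `T' ⟶ T`.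
By the Yoneda lemma this is the same as giving `S`-morphisms for the fibrewise addition and
scalar multiplication that satisfy the axioms of a module. -/
structure LinearScheme (S : Scheme.{0}) where
  total : Scheme.{0}
  proj : total ⟶ S
  [addCommGroup : ∀ {T : Scheme.{0}} (f : T ⟶ S), AddCommGroup (SectionsOver proj f)]
  [module : ∀ {T : Scheme.{0}} (f : T ⟶ S), Module Γ(T, ⊤) (SectionsOver proj f)]
  restrict_add : ∀ {T' T : Scheme.{0}} (h : T' ⟶ T) (f : T ⟶ S) (s t : SectionsOver proj f),
    (s + t).restrict h = s.restrict h + t.restrict h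
  restrict_smul : ∀ {T' T : Scheme.{0}} (h : T' ⟶ T) (f : T ⟶ S) (a : Γ(T, ⊤))
    (s : SectionsOver proj f), (a • s).restrict h = h.appTop.hom a • s.restrict h

namespace LinearScheme

attribute [instance] LinearScheme.addCommGroup LinearScheme.module

/-- An isomorphism of vector bundles: an isomorphism of schemes over `S` that is linear on the
fibres, that is, linear on sections over every `T ⟶ S`. -/
structure Iso {S : Scheme.{0}} (E F : LinearScheme S) where
  iso : E.total ≅ F.total
  comm : iso.hom ≫ F.proj = E.proj
  map_add : ∀ {T : Scheme.{0}} (f : T ⟶ S) (s t : SectionsOver E.proj f),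
    (s + t).map iso.hom comm = s.map iso.hom comm + t.map iso.hom comm
  map_smul : ∀ {T : Scheme.{0}} (f : T ⟶ S) (a : Γ(T, ⊤)) (s : SectionsOver E.proj f),
    (a • s).map iso.hom comm = a • s.map iso.hom comm

/-- Transport of structure: the linear scheme `q : V ⟶ S` whose sections over `f` are identified
by `e` with modules `M f` that have compatible restriction maps `ρ`. -/
def ofEquiv {V S : Scheme.{0}} (q : V ⟶ S) (M : ∀ {T : Scheme.{0}}, (T ⟶ S) → Type)
    [∀ {T : Scheme.{0}} (f : T ⟶ S), AddCommGroup (M f)]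
    [∀ {T : Scheme.{0}} (f : T ⟶ S), Module Γ(T, ⊤) (M f)]
    (e : ∀ {T : Scheme.{0}} (f : T ⟶ S), SectionsOver q f ≃ M f)
    (ρ : ∀ {T' T : Scheme.{0}} (h : T' ⟶ T) (f : T ⟶ S), M f →ₛₗ[h.appTop.hom] M (h ≫ f))
    (he : ∀ {T' T : Scheme.{0}} (h : T' ⟶ T) (f : T ⟶ S) (s : SectionsOver q f),
      e (h ≫ f) (s.restrict h) = ρ h f (e f s)) : LinearScheme S where
  total := V
  proj := q
  addCommGroup f := (e f).addCommGroup
  module {T} f :=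
    letI := (e f).addCommGroup
    (e f).module Γ(T, ⊤)
  restrict_add h f s t := by
    apply (e (h ≫ f)).injective
    rw [he, Equiv.add_def, Equiv.add_def, Equiv.apply_symm_apply, Equiv.apply_symm_apply,
      he, he, _root_.map_add]
  restrict_smul h f a s := by
    apply (e (h ≫ f)).injective
    rw [he, Equiv.smul_def, Equiv.smul_def, Equiv.apply_symm_apply, Equiv.apply_symm_apply, he,
      LinearMap.map_smulₛₗ]

/-- Sections of affine space `𝔸(Fin r; S)` over `T ⟶ S` are `r`-tuples of functions on `T`. -/
def trivialSectionsEquiv (r : ℕ) (S : Scheme.{0}) {T : Scheme.{0}} (f : T ⟶ S) :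
    SectionsOver (𝔸(Fin r; S) ↘ S) f ≃ (Fin r → Γ(T, ⊤)) where
  toFun s i := s.hom.appTop.hom (AffineSpace.coord S i)
  invFun v := ⟨AffineSpace.homOfVector f v, AffineSpace.homOfVector_over f v⟩
  left_inv s := by
    apply SectionsOver.ext
    apply AffineSpace.hom_ext
    · rw [AffineSpace.homOfVector_over]; exact s.comm.symm
    · intro i; rw [AffineSpace.homOfVector_appTop_coord]
  right_inv v := by
    funext i; exact AffineSpace.homOfVector_appTop_coord f v i

/-- The trivial vector bundle `S × 𝔸^r ⟶ S`, with coordinatewise operations. -/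
def trivial (r : ℕ) (S : Scheme.{0}) : LinearScheme S :=
  ofEquiv (𝔸(Fin r; S) ↘ S) (fun {T} _ => Fin r → Γ(T, ⊤)) (trivialSectionsEquiv r S)
    (fun h _ =>
      { toFun := fun v i => h.appTop.hom (v i)
        map_add' := fun v w => by funext i; exact _root_.map_add _ _ _
        map_smul' := fun a v => by funext i; exact _root_.map_mul _ _ _ })
    (fun h f s => by
      funext i
      change (h ≫ s.hom).appTop.hom _ = h.appTop.hom (s.hom.appTop.hom _)
      rw [Scheme.Hom.comp_appTop]; rfl)

/-- The ring homomorphism `R → Γ(T, 𝒪_T)` that corresponds to a morphism `f : T ⟶ Spec R`. -/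
def coeffHom {R : Type} [CommRing R] {T : Scheme.{0}} (f : T ⟶ Spec (.of R)) : R →+* Γ(T, ⊤) :=
  ((Scheme.ΓSpecIso (.of R)).inv ≫ f.appTop).hom

theorem coeffHom_comp {R R' : Type} [CommRing R] [CommRing R'] {T : Scheme.{0}}
    (φ : R →+* R') (s : T ⟶ Spec (.of R')) :
    coeffHom (s ≫ Spec.map (CommRingCat.ofHom φ)) = (coeffHom s).comp φ := by
  unfold coeffHom
  rw [Scheme.Hom.comp_appTop, ← Category.assoc, ← Scheme.ΓSpecIso_inv_naturality,
    Category.assoc]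
  rfl

theorem coeffHom_precomp {R : Type} [CommRing R] {T T' : Scheme.{0}} (h : T' ⟶ T)
    (f : T ⟶ Spec (.of R)) : coeffHom (h ≫ f) = h.appTop.hom.comp (coeffHom f) := by
  unfold coeffHom
  rw [Scheme.Hom.comp_appTop]
  rfl

/-- A ring homomorphism `R → Γ(T, 𝒪_T)` gives a morphism `T ⟶ Spec R`. -/
def homOfCoeff {R : Type} [CommRing R] {T : Scheme.{0}} (φ : R →+* Γ(T, ⊤)) :
    T ⟶ Spec (.of R) :=
  T.toSpecΓ ≫ Spec.map (CommRingCat.ofHom φ)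

theorem coeffHom_homOfCoeff {R : Type} [CommRing R] {T : Scheme.{0}} (φ : R →+* Γ(T, ⊤)) :
    coeffHom (homOfCoeff φ) = φ := by
  unfold coeffHom homOfCoeff
  rw [Scheme.Hom.comp_appTop, ← Category.assoc, ← Scheme.ΓSpecIso_inv_naturality,
    Category.assoc, Scheme.toSpecΓ_appTop]
  erw [Iso.inv_hom_id]
  rfl

theorem coeffHom_injective {R : Type} [CommRing R] {T : Scheme.{0}}
    {f g : T ⟶ Spec (.of R)} (h : coeffHom f = coeffHom g) : f = g := by
  apply AlgebraicGeometry.ext_to_Spec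
  exact CommRingCat.hom_ext h

theorem coeffHom_algebraMap {R N : Type} [CommRing R] [AddCommGroup N] [Module R N]
    {T : Scheme.{0}} {f : T ⟶ Spec (.of R)}
    (s : SectionsOver (Spec.map (CommRingCat.ofHom (algebraMap R (SymmetricAlgebra R N)))) f)
    (c : R) : coeffHom s.hom (algebraMap R _ c) = coeffHom f c := by
  have h := coeffHom_comp (algebraMap R (SymmetricAlgebra R N)) s.hom
  rw [s.comm] at h
  rw [h]; rfl

/-- For an `R`-module `N`, sections of `Spec (Sym N)` over `f : T ⟶ Spec R` are `R`-linear maps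
from `N` to `Γ(T, 𝒪_T)`. -/
def specSymSectionsEquiv (R N : Type) [CommRing R] [AddCommGroup N] [Module R N]
    {T : Scheme.{0}} (f : T ⟶ Spec (.of R)) :
    SectionsOver (Spec.map (CommRingCat.ofHom (algebraMap R (SymmetricAlgebra R N)))) f ≃
      (N →ₛₗ[coeffHom f] Γ(T, ⊤)) where
  toFun s :=
    { toFun := fun x => coeffHom s.hom (SymmetricAlgebra.ι R N x)
      map_add' := fun x y => by simp only [_root_.map_add]
      map_smul' := fun c x => by
        rw [_root_.map_smul, Algebra.smul_def, _root_.map_mul, coeffHom_algebraMap,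
          smul_eq_mul] }
  invFun l :=
    letI := (coeffHom f).toAlgebra
    let l' : N →ₗ[R] Γ(T, ⊤) :=
      { toFun := l
        map_add' := l.map_add
        map_smul' := fun c x => by
          rw [LinearMap.map_smulₛₗ, RingHom.id_apply, Algebra.smul_def]; rfl }
    ⟨homOfCoeff (SymmetricAlgebra.lift l').toRingHom, by
      apply coeffHom_injective
      rw [coeffHom_comp, coeffHom_homOfCoeff]
      ext c
      exact (SymmetricAlgebra.lift l').commutes c⟩
  left_inv s := by
    let := (coeffHom f).toAlgebra
    apply SectionsOver.ext
    apply coeffHom_injective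
    simp only [coeffHom_homOfCoeff]
    let ψ : SymmetricAlgebra R N →ₐ[R] Γ(T, ⊤) :=
      { coeffHom s.hom with commutes' := fun c => coeffHom_algebraMap s c }
    change (SymmetricAlgebra.lift _).toRingHom = ψ.toRingHom
    congr 1
    apply SymmetricAlgebra.algHom_ext
    ext x
    simp [ψ]
  right_inv l := by
    ext x
    simp [coeffHom_homOfCoeff]

/-- The linear scheme `Spec (Sym N)` over `Spec R` of an `R`-module `N`. -/
def specSym (R N : Type) [CommRing R] [AddCommGroup N] [Module R N] :
    LinearScheme (Spec (.of R)) :=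
  ofEquiv (Spec.map (CommRingCat.ofHom (algebraMap R (SymmetricAlgebra R N))))
    (fun {T} f => N →ₛₗ[coeffHom f] Γ(T, ⊤)) (specSymSectionsEquiv R N)
    (fun h f =>
      { toFun := fun l =>
          { toFun := fun x => h.appTop.hom (l x)
            map_add' := fun x y => by rw [_root_.map_add, _root_.map_add]
            map_smul' := fun c x => by
              rw [LinearMap.map_smulₛₗ, smul_eq_mul, _root_.map_mul, coeffHom_precomp]; rfl }
        map_add' := fun l m => by ext x; exact _root_.map_add h.appTop.hom (l x) (m x)
        map_smul' := fun a l => by ext x; exact _root_.map_mul h.appTop.hom a (l x) })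
    (fun h f s => by
      ext x
      change coeffHom (h ≫ s.hom) _ = h.appTop.hom (coeffHom s.hom _)
      rw [coeffHom_precomp]; rfl)

/-- The vector bundle `Spec (Sym (Mᵛ)) ⟶ Spec R` whose module of sections is the finitely
generated projective `R`-module `M`. -/
def ofModule (R M : Type) [CommRing R] [AddCommGroup M] [Module R M] :
    LinearScheme (Spec (.of R)) :=
  specSym R (Module.Dual R M)

end LinearScheme

/-! ### Complexification -/

/-- The morphism `Spec ℂ ⟶ Spec ℝ`. -/
def specComplexToReal : Spec (.of ℂ) ⟶ Spec (.of ℝ) :=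
  Spec.map (CommRingCat.ofHom (algebraMap ℝ ℂ))

/-- The complexification `X ×_{Spec ℝ} Spec ℂ` of a scheme `π : X ⟶ Spec ℝ` over `ℝ`. -/
def complexification {X : Scheme.{0}} (π : X ⟶ Spec (.of ℝ)) : Scheme.{0} :=
  pullback π specComplexToReal

/-- The projection `X_ℂ ⟶ X`. -/
def complexificationFst {X : Scheme.{0}} (π : X ⟶ Spec (.of ℝ)) : complexification π ⟶ X :=
  pullback.fst π specComplexToReal

/-- The structure morphism `X_ℂ ⟶ Spec ℂ`. -/
def complexificationSnd {X : Scheme.{0}} (π : X ⟶ Spec (.of ℝ)) :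
    complexification π ⟶ Spec (.of ℂ) :=
  pullback.snd π specComplexToReal

theorem complexification_condition {X : Scheme.{0}} (π : X ⟶ Spec (.of ℝ)) :
    complexificationFst π ≫ π = complexificationSnd π ≫ specComplexToReal :=
  pullback.condition

/-- The morphism to `X_ℂ` with given components. -/
def complexificationLift {X T : Scheme.{0}} {π : X ⟶ Spec (.of ℝ)} (a : T ⟶ X)
    (b : T ⟶ Spec (.of ℂ)) (h : a ≫ π = b ≫ specComplexToReal) : T ⟶ complexification π :=
  pullback.lift a b h

theorem complexificationLift_fst {X T : Scheme.{0}} {π : X ⟶ Spec (.of ℝ)} (a : T ⟶ X)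
    (b : T ⟶ Spec (.of ℂ)) (h : a ≫ π = b ≫ specComplexToReal) :
    complexificationLift a b h ≫ complexificationFst π = a :=
  pullback.lift_fst _ _ _

theorem complexificationLift_snd {X T : Scheme.{0}} {π : X ⟶ Spec (.of ℝ)} (a : T ⟶ X)
    (b : T ⟶ Spec (.of ℂ)) (h : a ≫ π = b ≫ specComplexToReal) :
    complexificationLift a b h ≫ complexificationSnd π = b :=
  pullback.lift_snd _ _ _

theorem complexification_hom_ext {X T : Scheme.{0}} {π : X ⟶ Spec (.of ℝ)}
    {f g : T ⟶ complexification π} (h : f ≫ complexificationFst π = g ≫ complexificationFst π)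
    (h' : f ≫ complexificationSnd π = g ≫ complexificationSnd π) : f = g :=
  pullback.hom_ext h h'

/-- The complexification `q_ℂ : V_ℂ ⟶ S_ℂ` of a morphism `q : V ⟶ S` of schemes over `ℝ`. -/
def complexificationMap {V S : Scheme.{0}} (q : V ⟶ S) (π : S ⟶ Spec (.of ℝ)) :
    complexification (q ≫ π) ⟶ complexification π :=
  complexificationLift (complexificationFst (q ≫ π) ≫ q) (complexificationSnd (q ≫ π))
    (by rw [Category.assoc]; exact complexification_condition _)

theorem complexificationMap_fst {V S : Scheme.{0}} (q : V ⟶ S) (π : S ⟶ Spec (.of ℝ)) :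
    complexificationMap q π ≫ complexificationFst π = complexificationFst (q ≫ π) ≫ q :=
  complexificationLift_fst _ _ _

theorem complexificationMap_snd {V S : Scheme.{0}} (q : V ⟶ S) (π : S ⟶ Spec (.of ℝ)) :
    complexificationMap q π ≫ complexificationSnd π = complexificationSnd (q ≫ π) :=
  complexificationLift_snd _ _ _

namespace LinearScheme

/-- Sections of `V_ℂ` over `f : T ⟶ S_ℂ` are sections of `V` over `T ⟶ S_ℂ ⟶ S`. -/
def complexifySectionsEquiv {V S : Scheme.{0}} (q : V ⟶ S) (π : S ⟶ Spec (.of ℝ))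
    {T : Scheme.{0}} (f : T ⟶ complexification π) :
    SectionsOver (complexificationMap q π) f ≃ SectionsOver q (f ≫ complexificationFst π) where
  toFun s := ⟨s.hom ≫ complexificationFst (q ≫ π), by
    rw [Category.assoc, ← complexificationMap_fst, ← Category.assoc, s.comm]⟩
  invFun t := ⟨complexificationLift t.hom (f ≫ complexificationSnd π) (by
      rw [← Category.assoc, t.comm, Category.assoc, Category.assoc,
        complexification_condition]), by
    apply complexification_hom_ext
    · rw [Category.assoc, complexificationMap_fst, ← Category.assoc, complexificationLift_fst,
        t.comm]
    · rw [Category.assoc, complexificationMap_snd, complexificationLift_snd]⟩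
  left_inv s := by
    apply SectionsOver.ext
    apply complexification_hom_ext
    · rw [complexificationLift_fst]
    · rw [complexificationLift_snd, ← complexificationMap_snd, ← Category.assoc, s.comm]
  right_inv t := by
    apply SectionsOver.ext
    exact complexificationLift_fst _ _ _

/-- The complexification `q_ℂ : V_ℂ ⟶ S_ℂ` of a vector bundle `q : V ⟶ S`. -/
def complexify {S : Scheme.{0}} (E : LinearScheme S) (π : S ⟶ Spec (.of ℝ)) :
    LinearScheme (complexification π) :=
  ofEquiv (complexificationMap E.proj π)
    (fun f => SectionsOver E.proj (f ≫ complexificationFst π))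
    (complexifySectionsEquiv E.proj π)
    (fun h f =>
      { toFun := fun s => s.restrict h
        map_add' := E.restrict_add h _
        map_smul' := E.restrict_smul h _ })
    (fun h f s => by
      apply SectionsOver.ext
      exact Category.assoc _ _ _)

end LinearScheme

/-! ### Galois descent of `E ⊕ σ^*E` for modules over `A ⊗ ℂ` -/

section Descent

variable (A : Type) [CommRing A] [Algebra ℝ A]

/-- The canonical real structure `σ` on the complexification of `Spec A`: on `A ⊗ ℂ` it is
complex conjugation on the second factor. -/
def conjHom : A ⊗[ℝ] ℂ →ₐ[A] A ⊗[ℝ] ℂ :=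
  Algebra.TensorProduct.map (AlgHom.id A A) Complex.conjAe.toAlgHom

theorem conjHom_conjHom (c : A ⊗[ℝ] ℂ) : conjHom A (conjHom A c) = c := by
  induction c with
  | zero => simp
  | tmul a z => simp [conjHom]
  | add x y hx hy => rw [map_add, map_add, hx, hy]

/-- The pull-back `σ^*E` of an `A ⊗ ℂ`-module `E`: since `σ` is an involution, this is `E` with
`c` acting as `σ(c)`. -/
def ConjPullback (E : Type) : Type := E

instance (E : Type) [AddCommGroup E] : AddCommGroup (ConjPullback E) :=
  inferInstanceAs (AddCommGroup E)

instance (E : Type) [AddCommGroup E] [Module (A ⊗[ℝ] ℂ) E] :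
    Module (A ⊗[ℝ] ℂ) (ConjPullback E) :=
  Module.compHom E (conjHom A).toRingHom

variable (E : Type) [AddCommGroup E] [Module (A ⊗[ℝ] ℂ) E]

/-- The `σ`-semilinear involution of `E ⊕ σ^*E` that exchanges the two summands. -/
def exchange : (E × ConjPullback E) →ₛₗ[(conjHom A).toRingHom] (E × ConjPullback E) where
  toFun w := (w.2, w.1)
  map_add' _ _ := rfl
  map_smul' c w := by
    refine Prod.ext rfl ?_
    change c • (w.1 : E) = (conjHom A (conjHom A c)) • (w.1 : E)
    rw [conjHom_conjHom]

/-- The `A`-module `E_ℝ` to which `E ⊕ σ^*E` with the exchange descends: its invariants. -/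
def descended : Submodule A (RestrictScalars A (A ⊗[ℝ] ℂ) (E × ConjPullback E)) where
  carrier := {w | exchange A E w = w}
  add_mem' {v w} hv hw := by
    have : exchange A E (v + w) = exchange A E v + exchange A E w := map_add _ _ _
    exact this.trans (congrArg₂ _ hv hw)
  zero_mem' := map_zero (exchange A E)
  smul_mem' a w hw := by
    have h := (exchange A E).map_smulₛₗ (algebraMap A (A ⊗[ℝ] ℂ) a) w
    have h' : (conjHom A).toRingHom (algebraMap A (A ⊗[ℝ] ℂ) a) = algebraMap A (A ⊗[ℝ] ℂ) a :=
      (conjHom A).commutes a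
    rw [h'] at h
    exact h.trans (congrArg (algebraMap A (A ⊗[ℝ] ℂ) a • ·) hw)

instance : AddCommGroup (descended A E) := Submodule.addCommGroup _

instance : Module A (descended A E) := Submodule.module _

end Descent

/-! ### The sphere and the line bundles `pr₁^* 𝒪(n)` -/

open MvPolynomial in
/-- The coordinate ring `ℝ[x, y, z] / (x² + y² + z² - 1)`. -/
def SphereRing : Type :=
  MvPolynomial (Fin 3) ℝ ⧸
    Ideal.span {(X 0 ^ 2 + X 1 ^ 2 + X 2 ^ 2 - 1 : MvPolynomial (Fin 3) ℝ)}

instance : CommRing SphereRing := inferInstanceAs (CommRing (_ ⧸ _))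

instance : Algebra ℝ SphereRing := inferInstanceAs (Algebra ℝ (_ ⧸ _))

/-- The real algebraic sphere `𝕊²`. -/
def sphere : Scheme.{0} := Spec (.of SphereRing)

/-- The structure morphism `𝕊² ⟶ Spec ℝ`. -/
def sphereToSpecReal : sphere ⟶ Spec (.of ℝ) :=
  Spec.map (CommRingCat.ofHom (algebraMap ℝ SphereRing))

namespace BiProj

open MvPolynomial

/-- The bihomogeneous coordinate ring `ℂ[x₀, x₁, y₀, y₁]` of `ℙ¹ × ℙ¹` over `ℂ`; the `xᵢ` are
indexed by the left summand and the `yᵢ` by the right one. -/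
abbrev CoordRing : Type := MvPolynomial (Fin 2 ⊕ Fin 2) ℂ

/-- The homogeneous coordinate `xᵢ` of the first factor. -/
def x (i : Fin 2) : CoordRing := X (Sum.inl i)

/-- The homogeneous coordinate `yᵢ` of the second factor. -/
def y (i : Fin 2) : CoordRing := X (Sum.inr i)

/-- The bidegrees: each `xᵢ` has bidegree `(1, 0)` and each `yᵢ` has bidegree `(0, 1)`. -/
def bideg : Fin 2 ⊕ Fin 2 → ℕ × ℕ := Sum.elim (fun _ => (1, 0)) (fun _ => (0, 1))

/-- The equation `T = x₀y₀ + x₁y₁` of the curve of bidegree `(1, 1)` whose complement is the affine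
open subset `𝕊²_ℂ` of `ℙ¹ × ℙ¹`. -/
def tEq : CoordRing := x 0 * y 0 + x 1 * y 1

/-- The localization `ℂ[x₀, x₁, y₀, y₁]_T`. -/
def Loc : Type := Localization.Away tEq

instance : CommRing Loc := inferInstanceAs (CommRing (Localization.Away tEq))

instance : Algebra CoordRing Loc := inferInstanceAs (Algebra CoordRing (Localization.Away tEq))

instance : IsLocalization.Away tEq Loc :=
  inferInstanceAs (IsLocalization.Away tEq (Localization.Away tEq))

instance : Algebra ℂ Loc := ((algebraMap CoordRing Loc).comp C).toAlgebra

instance : IsScalarTower ℂ CoordRing Loc := IsScalarTower.of_algebraMap_eq fun _ => rfl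

instance : Algebra ℝ Loc := ((algebraMap ℂ Loc).comp (algebraMap ℝ ℂ)).toAlgebra

instance : IsScalarTower ℝ ℂ Loc := IsScalarTower.of_algebraMap_eq fun _ => rfl

/-- `T⁻¹` -/
def tInv : Loc := IsLocalization.Away.invSelf tEq

/-- The elements `p / T^k` of `ℂ[x₀, x₁, y₀, y₁]_T` with `p` bihomogeneous of bidegree
`(n + k, k)`, that is, the sections over the affine open set `{T ≠ 0}` of the line bundle
`pr₁^* 𝒪(n)` on `ℙ¹ × ℙ¹`. For `n = 0` this is the ring of functions on `{T ≠ 0}`. -/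
def IsTwist (n : ℕ) (b : Loc) : Prop :=
  ∃ (k : ℕ) (p : CoordRing), p.IsWeightedHomogeneous bideg (n + k, k) ∧
    b = algebraMap CoordRing Loc p * tInv ^ k

theorem tEq_tInv : algebraMap CoordRing Loc tEq * tInv = 1 :=
  IsLocalization.Away.mul_invSelf tEq

theorem isWeightedHomogeneous_xy (i j : Fin 2) :
    (x i * y j).IsWeightedHomogeneous bideg (1, 1) :=
  (isWeightedHomogeneous_X ℂ bideg (Sum.inl i)).mul (isWeightedHomogeneous_X ℂ bideg (Sum.inr j))

theorem isWeightedHomogeneous_tEq : tEq.IsWeightedHomogeneous bideg (1, 1) :=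
  (isWeightedHomogeneous_xy 0 0).add (isWeightedHomogeneous_xy 1 1)

theorem IsTwist.add {n : ℕ} {a b : Loc} (ha : IsTwist n a) (hb : IsTwist n b) :
    IsTwist n (a + b) := by
  obtain ⟨k, p, hp, rfl⟩ := ha
  obtain ⟨l, q, hq, rfl⟩ := hb
  refine ⟨k + l, p * tEq ^ l + q * tEq ^ k, ?_, ?_⟩
  · refine IsWeightedHomogeneous.add ?_ ?_
    · convert hp.mul (isWeightedHomogeneous_tEq.pow l) using 1
      ext <;> simp [add_assoc]
    · convert hq.mul (isWeightedHomogeneous_tEq.pow k) using 1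
      ext <;> simp <;> ring
  · have h1 : ∀ m : ℕ, algebraMap CoordRing Loc tEq ^ m * tInv ^ m = 1 := fun m => by
      rw [← mul_pow, tEq_tInv, one_pow]
    simp only [map_add, map_mul, map_pow, pow_add]
    linear_combination (-algebraMap CoordRing Loc p * tInv ^ k) * h1 l +
      (-algebraMap CoordRing Loc q * tInv ^ l) * h1 k

theorem IsTwist.mul {m n : ℕ} {a b : Loc} (ha : IsTwist m a) (hb : IsTwist n b) :
    IsTwist (m + n) (a * b) := by
  obtain ⟨k, p, hp, rfl⟩ := ha
  obtain ⟨l, q, hq, rfl⟩ := hb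
  refine ⟨k + l, p * q, ?_, ?_⟩
  · convert hp.mul hq using 1
    ext <;> simp
    ring
  · rw [map_mul, pow_add]; ring

theorem isTwist_zero (n : ℕ) : IsTwist n 0 :=
  ⟨0, 0, isWeightedHomogeneous_zero ℂ bideg _, by simp⟩

theorem isTwist_C (c : ℂ) : IsTwist 0 (algebraMap ℂ Loc c) :=
  ⟨0, C c, isWeightedHomogeneous_C bideg c, by
    rw [pow_zero, mul_one, ← algebraMap_eq, ← IsScalarTower.algebraMap_apply]⟩

/-- The images of the coordinates `x`, `y`, `z` of the sphere under the isomorphism `ψ` from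
`ℙ¹ × ℙ¹` to the quadric `X² + Y² + Z² = T²` given by
`[X : Y : Z : T] = [x₀y₁ + x₁y₀ : i(x₁y₀ - x₀y₁) : x₀y₀ - x₁y₁ : x₀y₀ + x₁y₁]`. -/
def psiCoord : Fin 3 → Loc :=
  ![algebraMap CoordRing Loc (x 0 * y 1 + x 1 * y 0) * tInv,
    algebraMap CoordRing Loc (C Complex.I * (x 1 * y 0 - x 0 * y 1)) * tInv,
    algebraMap CoordRing Loc (x 0 * y 0 - x 1 * y 1) * tInv]

theorem psiCoord_sq : psiCoord 0 ^ 2 + psiCoord 1 ^ 2 + psiCoord 2 ^ 2 = 1 := by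
  have hI : (C Complex.I : CoordRing) ^ 2 = -1 := by
    rw [← C_pow, Complex.I_sq, C_neg, C_1]
  have h : (x 0 * y 1 + x 1 * y 0) ^ 2 + (C Complex.I * (x 1 * y 0 - x 0 * y 1)) ^ 2 +
      (x 0 * y 0 - x 1 * y 1) ^ 2 = tEq ^ 2 := by
    rw [mul_pow, hI, tEq]; ring
  have h' := congrArg (algebraMap CoordRing Loc) h
  rw [map_add, map_add, map_pow, map_pow, map_pow, map_pow] at h'
  have h1 : algebraMap CoordRing Loc tEq ^ 2 * tInv ^ 2 = 1 := by
    rw [← mul_pow, tEq_tInv, one_pow]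
  simp only [psiCoord, Matrix.cons_val_zero, Matrix.cons_val_one, Matrix.cons_val]
  linear_combination tInv ^ 2 * h' + h1

theorem isTwist_psiCoord (i : Fin 3) : IsTwist 0 (psiCoord i) := by
  fin_cases i
  · exact ⟨1, _, (isWeightedHomogeneous_xy 0 1).add (isWeightedHomogeneous_xy 1 0), by
      simp [psiCoord]⟩
  · exact ⟨1, _, IsWeightedHomogeneous.C_mul
      ((isWeightedHomogeneous_xy 1 0).sub (isWeightedHomogeneous_xy 0 1)) Complex.I, by
      simp [psiCoord]⟩
  · exact ⟨1, _, (isWeightedHomogeneous_xy 0 0).sub (isWeightedHomogeneous_xy 1 1), by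
      simp [psiCoord]⟩

/-- The ring homomorphism `ψ^*` on real functions on the sphere. -/
def psiReal : SphereRing →ₐ[ℝ] Loc :=
  Ideal.Quotient.liftₐ _ (aeval psiCoord) (by
    intro a ha
    rw [← RingHom.mem_ker]
    refine (Ideal.span_le.mpr ?_) ha
    rintro _ rfl
    simp [RingHom.mem_ker, psiCoord_sq])

/-- The ring homomorphism `ψ^*` from the functions on `𝕊²_ℂ` to the functions on the open subset
`{T ≠ 0}` of `ℙ¹ × ℙ¹`. -/
def psi : SphereRing ⊗[ℝ] ℂ →ₐ[ℝ] Loc :=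
  Algebra.TensorProduct.lift psiReal (IsScalarTower.toAlgHom ℝ ℂ Loc)
    (fun _ _ => Commute.all _ _)

theorem isTwist_psi (c : SphereRing ⊗[ℝ] ℂ) : IsTwist 0 (psi c) := by
  induction c with
  | zero => rw [map_zero]; exact isTwist_zero 0
  | add a b ha hb => rw [map_add]; exact ha.add hb
  | tmul a z =>
    obtain ⟨p, rfl⟩ := Ideal.Quotient.mk_surjective a
    have h : psi ((Ideal.Quotient.mk _ p : SphereRing) ⊗ₜ z) =
        aeval psiCoord p * algebraMap ℂ Loc z :=
      Algebra.TensorProduct.lift_tmul _ _ _ _ _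
    refine (congrArg (IsTwist 0) h).mpr ?_
    refine IsTwist.mul (m := 0) (n := 0) ?_ (isTwist_C z)
    induction p using MvPolynomial.induction_on with
    | C r =>
      rw [aeval_C, IsScalarTower.algebraMap_apply ℝ ℂ Loc]
      exact isTwist_C _
    | add p q hp hq => rw [map_add]; exact (hp rfl).add (hq rfl)
    | mul_X p i hp => rw [map_mul, aeval_X]; exact (hp rfl).mul (isTwist_psiCoord i)

instance : Module (SphereRing ⊗[ℝ] ℂ) Loc := Module.compHom Loc psi.toRingHom

/-- The module of sections over `𝕊²_ℂ = {T ≠ 0} ⊆ ℙ¹ × ℙ¹` of the line bundle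
`L_n = pr₁^* 𝒪(n)`. -/
def lineBundle (n : ℕ) : Submodule (SphereRing ⊗[ℝ] ℂ) Loc where
  carrier := {b | IsTwist n b}
  add_mem' := IsTwist.add
  zero_mem' := isTwist_zero n
  smul_mem' c b hb := by
    have h := (isTwist_psi c).mul hb
    rw [zero_add] at h
    exact h

end BiProj

/-- The real rank 2 vector bundle `q_n : V_n ⟶ 𝕊²` to which `L_n ⊕ σ^*L_n` descends. -/
def sphereBundle (n : ℕ) : LinearScheme sphere :=
  LinearScheme.ofModule SphereRing (descended SphereRing (BiProj.lineBundle n))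

end

/-! The real structure of the quadric exchanges the two factors of `ℙ¹ × ℙ¹`, so `σ^*L_n` is the
restriction of `𝒪(0, n)`, with sections `yᵢⁿ` to match the sections `xᵢⁿ` of `L_n`. On `𝕊²_ℂ` the
functions `p_ij = x_i y_j / T` satisfy `p₀₀ + p₁₁ = 1`, so `a₀ p₀₀ⁿ + a₁ p₁₁ⁿ = 1` for some
functions `a₀`, `a₁`. Hence the matrix with rows `(x₀ⁿ, -a₁y₁ⁿ)` and `(x₁ⁿ, a₀y₀ⁿ)` has determinant
`Tⁿ`, which is invertible, and its rows form a frame of `L_n ⊕ σ^*L_n`: by Cramer's rule, the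
coefficients of any section are quotients of bidegree `(0, 0)` (`nonempty_lineBundle_prod_equiv`).
That such quotients are functions on the sphere, in a unique way, is `exists_psi_eq` and
`psi_injective`.

The rest is formal. Galois descent (`bijective_descendedBaseChange`) identifies the complexification
of the descended module with `L_n ⊕ σ^*L_n`. The bundle is `Spec Sym` of the dual of that module, so
freeness has to pass to the dual; duals commute with the finite free base change `A → A ⊗ ℂ`
(`baseChangeDualEquiv`). Sections of the complexified bundle over `T` are semilinear maps from the
dual to the functions on `T`; these extend to the base change of the dual, where a basis turns them
into pairs of functions. This is natural in `T`, so Yoneda gives the isomorphism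
(`nonempty_iso_complexify_specSym`). -/

noncomputable section

/-! ### Duals and finite free base change -/

section BaseChange

variable (A B D : Type) [CommRing A] [CommRing B] [Algebra A B] [Module.Free A B]
  [Module.Finite A B] [AddCommGroup D] [Module A D]

/-- A basis `b` of `B` over `A` makes both sides families of functionals on `D`: a map `D → B` is
the family of its coordinates. Finiteness is needed of `B` only, so `D` is arbitrary. -/
theorem bijective_baseChange_dual : Function.Bijective
    (IsBaseChange.linearMapRightBaseChangeHom B D (Algebra.linearMap A B)) := by
  classical
  have := Module.Free.ChooseBasisIndex.fintype A B
  let b := Module.Free.chooseBasis A B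
  let u := TensorProduct.equivFinsuppOfBasisLeft (N := Module.Dual A D) b
  have key : ∀ (g : Module.Free.ChooseBasisIndex A B →₀ Module.Dual A D) (d : D),
      IsBaseChange.linearMapRightBaseChangeHom B D (Algebra.linearMap A B) (u.symm g) d =
        ∑ i, g i d • b i := by
    intro g d
    rw [TensorProduct.equivFinsuppOfBasisLeft_symm_apply, Finsupp.sum_fintype _ _ (by simp),
      map_sum, LinearMap.sum_apply]
    refine Finset.sum_congr rfl fun i _ => ?_
    change (b i • (LinearMap.compRight A (Algebra.linearMap A B) (g i))) d = _
    simp [Algebra.smul_def, mul_comm]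
  constructor
  · rw [injective_iff_map_eq_zero]
    intro t ht
    obtain ⟨g, rfl⟩ := u.symm.surjective t
    have : g = 0 := by
      ext i d
      have h := key g d
      rw [ht, LinearMap.zero_apply] at h
      exact Fintype.linearIndependent_iff.mp b.linearIndependent (fun i => g i d) h.symm i
    rw [this, map_zero]
  · intro h
    refine ⟨u.symm (Finsupp.equivFunOnFinite.symm fun i => b.coord i ∘ₗ h), ?_⟩
    ext d
    rw [key]
    exact b.sum_repr (h d)

/-- For a finite free `A`-algebra `B`, base change to `B` of the dual of an `A`-module `D` gives the
`B`-dual of `B ⊗ D`. -/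
def baseChangeDualEquiv : B ⊗[A] Module.Dual A D ≃ₗ[B] Module.Dual B (B ⊗[A] D) :=
  LinearEquiv.ofBijective _ (bijective_baseChange_dual A B D) ≪≫ₗ
    LinearMap.liftBaseChangeEquiv B

variable {A B D} in
/-- If `B ⊗ D` is free of rank `r`, then so is `B ⊗ Dᵛ`. -/
def baseChangeDualEquivPi {r : ℕ} (e : B ⊗[A] D ≃ₗ[B] (Fin r → B)) :
    B ⊗[A] Module.Dual A D ≃ₗ[B] (Fin r → B) :=
  baseChangeDualEquiv A B D ≪≫ₗ LinearEquiv.dualMap e.symm ≪≫ₗ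
    ((Pi.basisFun B (Fin r)).constr B).symm

end BaseChange

/-! ### Galois descent along `ℝ → ℂ` -/

section Descent

variable (A : Type) [CommRing A] [Algebra ℝ A]
variable (E : Type) [AddCommGroup E] [Module (A ⊗[ℝ] ℂ) E]

attribute [local instance] RestrictScalars.moduleOrig

/-- An element of the descended module, as an element of `E ⊕ σ^*E`. -/
def descendedVal (w : descended A E) : E × ConjPullback E := w.1

theorem exchange_descendedVal (w : descended A E) :
    exchange A E (descendedVal A E w) = descendedVal A E w := w.2

theorem exists_descendedVal {w : E × ConjPullback E} (h : exchange A E w = w) :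
    ∃ v, descendedVal A E v = w := ⟨⟨w, h⟩, rfl⟩

theorem descendedVal_injective : Function.Injective (descendedVal A E) :=
  Subtype.val_injective

/-- The canonical map from the complexification of the descended module to `E ⊕ σ^*E`. -/
def descendedBaseChange : (A ⊗[ℝ] ℂ) ⊗[A] descended A E →ₗ[A ⊗[ℝ] ℂ] E × ConjPullback E :=
  (LinearMap.liftBaseChange (A ⊗[ℝ] ℂ) (descended A E).subtype :
    _ →ₗ[A ⊗[ℝ] ℂ] RestrictScalars A (A ⊗[ℝ] ℂ) (E × ConjPullback E))

theorem descendedBaseChange_tmul (c : A ⊗[ℝ] ℂ) (w : descended A E) :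
    descendedBaseChange A E (c ⊗ₜ w) = c • descendedVal A E w :=
  LinearMap.liftBaseChange_tmul (A ⊗[ℝ] ℂ) (descended A E).subtype _ _

theorem exchange_smul (c : A ⊗[ℝ] ℂ) (w : E × ConjPullback E) :
    exchange A E (c • w) = conjHom A c • exchange A E w :=
  (exchange A E).map_smulₛₗ c w

theorem I_smul_I_smul {W : Type} [AddCommGroup W] [Module (A ⊗[ℝ] ℂ) W] (w : W) :
    ((1 : A) ⊗ₜ[ℝ] Complex.I : A ⊗[ℝ] ℂ) • ((1 : A) ⊗ₜ[ℝ] Complex.I : A ⊗[ℝ] ℂ) • w = -w := by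
  rw [smul_smul, Algebra.TensorProduct.tmul_mul_tmul, Complex.I_mul_I, TensorProduct.tmul_neg,
    mul_one, ← Algebra.TensorProduct.one_def, neg_smul, one_smul]

theorem conjHom_I : conjHom A ((1 : A) ⊗ₜ[ℝ] Complex.I) = -((1 : A) ⊗ₜ[ℝ] Complex.I) := by
  simp [conjHom, TensorProduct.tmul_neg]

theorem half_add_half : ((1 : A) ⊗ₜ[ℝ] (1 / 2 : ℂ) : A ⊗[ℝ] ℂ) + (1 : A) ⊗ₜ[ℝ] (1 / 2 : ℂ) = 1 := by
  rw [← TensorProduct.tmul_add, add_halves, Algebra.TensorProduct.one_def]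

/-- The invariants of a semilinear involution are a real form: every vector is uniquely `v₀ + i v₁`
with `v₀`, `v₁` invariant. Nothing is required of `E`. -/
theorem bijective_descendedBaseChange : Function.Bijective (descendedBaseChange A E) := by
  let i : A ⊗[ℝ] ℂ := (1 : A) ⊗ₜ[ℝ] Complex.I
  let t : A ⊗[ℝ] ℂ := (1 : A) ⊗ₜ[ℝ] (1 / 2 : ℂ)
  have ht : t + t = 1 := half_add_half A
  have hi : conjHom A i = -i := conjHom_I A
  constructor
  · rw [injective_iff_map_eq_zero]
    intro z hz
    let b := Algebra.TensorProduct.basis A Complex.basisOneI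
    obtain ⟨g, rfl⟩ := (TensorProduct.equivFinsuppOfBasisLeft
      (N := descended A E) b).symm.surjective z
    rw [TensorProduct.equivFinsuppOfBasisLeft_symm_apply, Finsupp.sum_fintype _ _ (by simp),
      Fin.sum_univ_two] at hz ⊢
    have hb0 : b 0 = 1 := by simp [b, Algebra.TensorProduct.one_def]
    have hb1 : b 1 = i := by simp [b, i]
    rw [hb0, hb1] at hz ⊢
    rw [map_add, descendedBaseChange_tmul, descendedBaseChange_tmul, one_smul] at hz
    -- From `v₀ + i v₁ = 0` the involution gives `v₀ - i v₁ = 0`; the sum of the two kills `v₀`,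
    -- since 2 is invertible, and then `v₁`.
    have hz' := congrArg (exchange A E) hz
    rw [map_add, exchange_smul, exchange_descendedVal, exchange_descendedVal, hi,
      map_zero (exchange A E), neg_smul] at hz'
    have e0 : descendedVal A E (g 0) = 0 := by
      have h2 : descendedVal A E (g 0) + descendedVal A E (g 0) = 0 := by
        rw [← add_zero (0 : E × ConjPullback E)]
        refine Eq.trans ?_ (congrArg₂ (· + ·) hz hz')
        abel
      rw [← one_smul (A ⊗[ℝ] ℂ) (descendedVal A E (g 0)), ← ht, add_smul, ← smul_add, h2, smul_zero]
    have e1 : descendedVal A E (g 1) = 0 := by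
      rw [e0, zero_add] at hz
      have h : i • i • _ = _ := I_smul_I_smul A (descendedVal A E (g 1))
      rw [hz, smul_zero] at h
      exact neg_eq_zero.mp h.symm
    have e0' : g 0 = 0 := descendedVal_injective A E e0
    have e1' : g 1 = 0 := descendedVal_injective A E e1
    rw [e0', e1', tmul_zero, tmul_zero, add_zero]
  · intro w
    -- With `ε` the exchange, `w = ½(w + εw) - (i/2)(iw - iεw)`, and both brackets are invariant
    -- because conjugation negates `i`.
    have hxx : exchange A E (exchange A E w) = w := rfl
    obtain ⟨v, hv⟩ : ∃ v, descendedVal A E v = w + exchange A E w :=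
      exists_descendedVal A E (by rw [map_add, hxx, add_comm])
    obtain ⟨u, hu⟩ : ∃ u, descendedVal A E u = i • w - i • exchange A E w :=
      exists_descendedVal A E (by
        rw [map_sub, exchange_smul, exchange_smul, hxx, hi, neg_smul, neg_smul]; abel)
    refine ⟨t ⊗ₜ v - (t * i) ⊗ₜ u, ?_⟩
    have hti : ∀ z : E × ConjPullback E, (t * i) • z = t • i • z := fun z => mul_smul t i z
    rw [map_sub, descendedBaseChange_tmul, descendedBaseChange_tmul, hv, hu, hti, smul_sub i,
      I_smul_I_smul A w, I_smul_I_smul A (exchange A E w), ← smul_sub]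
    have h : w + exchange A E w - (-w - -exchange A E w) = w + w := by abel
    rw [h, smul_add]
    exact (add_smul t t w).symm.trans ((congrArg (· • w) ht).trans (one_smul _ w))

/-- Galois descent: the complexification of the descended module is `E ⊕ σ^*E`. -/
def descendedBaseChangeEquiv :
    (A ⊗[ℝ] ℂ) ⊗[A] descended A E ≃ₗ[A ⊗[ℝ] ℂ] E × ConjPullback E :=
  LinearEquiv.ofBijective _ (bijective_descendedBaseChange A E)

end Descent
end

/-! ### The functions on `𝕊²_ℂ` as the part of bidegree `(0, 0)` of `ℂ[x₀, x₁, y₀, y₁]_T` -/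

noncomputable section

namespace BiProj

open MvPolynomial

/-- The coordinate ring of the complexified sphere. -/
abbrev ComplexSphereRing : Type := SphereRing ⊗[ℝ] ℂ

/-- A sphere coordinate in the complexified coordinate ring. -/
def coord (i : Fin 3) : ComplexSphereRing :=
  (Ideal.Quotient.mk _ (X i) : SphereRing) ⊗ₜ 1

/-- A complex constant in the complexified coordinate ring. -/
def const : ℂ →+* ComplexSphereRing :=
  (Algebra.TensorProduct.includeRight : ℂ →ₐ[ℝ] ComplexSphereRing).toRingHom

theorem coord_sq : coord 0 ^ 2 + coord 1 ^ 2 + coord 2 ^ 2 = 1 := by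
  have h : (Ideal.Quotient.mk (Ideal.span {(X 0 ^ 2 + X 1 ^ 2 + X 2 ^ 2 - 1 :
      MvPolynomial (Fin 3) ℝ)}) (X 0 ^ 2 + X 1 ^ 2 + X 2 ^ 2 - 1)) = 0 :=
    Ideal.Quotient.eq_zero_iff_mem.mpr (Ideal.mem_span_singleton_self _)
  rw [map_sub, map_add, map_add, map_pow, map_pow, map_pow, map_one, sub_eq_zero] at h
  have h' := congrArg (Algebra.TensorProduct.includeLeft (R := ℝ) (S := ℝ) (A := SphereRing)
    (B := ℂ)) (show (_ : SphereRing) = 1 from h)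
  rw [map_one] at h'
  rw [← h']
  erw [map_add, map_add, map_pow, map_pow, map_pow]
  rfl

theorem psi_coord (i : Fin 3) : psi (coord i) = psiCoord i := by
  have h : psi (coord i) = aeval psiCoord (X i : MvPolynomial (Fin 3) ℝ) * algebraMap ℂ Loc 1 :=
    Algebra.TensorProduct.lift_tmul _ _ _ _ _
  rw [h, aeval_X, map_one, mul_one]

theorem psi_const (c : ℂ) : psi (const c) = algebraMap ℂ Loc c := by
  have h : psi (const c) = psiReal 1 * algebraMap ℂ Loc c :=
    Algebra.TensorProduct.lift_tmul _ _ _ _ _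
  rw [h, map_one, one_mul]

/-- Two ring homomorphisms from the complexified coordinate ring agree if they agree on constants
and coordinates. -/
theorem ringHom_ext {G : Type} [CommRing G] {f g : ComplexSphereRing →+* G}
    (hc : ∀ c, f (const c) = g (const c)) (hx : ∀ i, f (coord i) = g (coord i)) : f = g := by
  refine RingHom.ext fun b => ?_
  induction b using TensorProduct.induction_on with
  | zero => rw [map_zero, map_zero]
  | add x y hx hy => rw [map_add, map_add, hx, hy]
  | tmul a z =>
    have hz : a ⊗ₜ z = (a ⊗ₜ 1 : ComplexSphereRing) * const z := by
      change _ = a ⊗ₜ[ℝ] (1 : ℂ) * (1 : SphereRing) ⊗ₜ z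
      rw [Algebra.TensorProduct.tmul_mul_tmul, mul_one, one_mul]
    rw [hz, map_mul, map_mul, hc]
    congr 1
    obtain ⟨p, rfl⟩ := Ideal.Quotient.mk_surjective a
    let u : MvPolynomial (Fin 3) ℝ →+* ComplexSphereRing :=
      (Algebra.TensorProduct.includeLeft (R := ℝ) (S := ℝ) (A := SphereRing)
        (B := ℂ)).toRingHom.comp (Ideal.Quotient.mk _)
    suffices h : f.comp u = g.comp u from RingHom.congr_fun h p
    refine MvPolynomial.ringHom_ext (fun r => ?_) hx
    have hr : u (C r) = const (r : ℂ) := by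
      change (algebraMap ℝ SphereRing r) ⊗ₜ[ℝ] (1 : ℂ) = (1 : SphereRing) ⊗ₜ (r : ℂ)
      rw [Algebra.algebraMap_eq_smul_one, TensorProduct.smul_tmul]
      congr 1
      simp
    rw [RingHom.comp_apply, RingHom.comp_apply, hr, hc]

/-- The functions `x_i y_j / T` on the complexified sphere. -/
def proj : Fin 2 → Fin 2 → ComplexSphereRing :=
  ![![const (1 / 2) * (1 + coord 2), const (1 / 2) * (coord 0 + const Complex.I * coord 1)],
    ![const (1 / 2) * (coord 0 - const Complex.I * coord 1), const (1 / 2) * (1 - coord 2)]]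

theorem const_half : const (1 / 2) + const (1 / 2) = 1 := by
  rw [← map_add, add_halves, map_one]

theorem const_I : const Complex.I * const Complex.I = -1 := by
  rw [← map_mul, Complex.I_mul_I, map_neg, map_one]

theorem proj_trace : proj 0 0 + proj 1 1 = 1 := by
  simp only [proj, Matrix.cons_val_zero, Matrix.cons_val_one]
  linear_combination const_half

/-- The matrix `proj` has rank one. Its determinant is `(1 - x² - y² - z²)/4`, which vanishes on the
sphere; every other case is this one up to commutativity, or trivial. -/
theorem proj_mul_proj (i j k l : Fin 2) : proj i j * proj k l = proj i l * proj k j := by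
  have h : proj 0 0 * proj 1 1 = proj 0 1 * proj 1 0 := by
    simp only [proj, Matrix.cons_val_zero, Matrix.cons_val_one]
    linear_combination -(const (1 / 2)) ^ 2 * coord_sq +
      (const (1 / 2)) ^ 2 * coord 1 ^ 2 * const_I
  fin_cases i <;> fin_cases j <;> fin_cases k <;> fin_cases l <;>
    first
      | exact h
      | exact h.symm
      | exact mul_comm _ _
      | exact (mul_comm _ _).trans h
      | exact (mul_comm _ _).trans h.symm
      | exact h.trans (mul_comm _ _)
      | exact (mul_comm _ _).trans (h.trans (mul_comm _ _))
      | exact (mul_comm _ _).trans (h.symm.trans (mul_comm _ _))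
      | rfl

theorem psi_proj (i j : Fin 2) : psi (proj i j) = algebraMap CoordRing Loc (x i * y j) * tInv := by
  have hI : algebraMap CoordRing Loc (C Complex.I) = algebraMap ℂ Loc Complex.I := rfl
  have h2 : algebraMap ℂ Loc (1 / 2) + algebraMap ℂ Loc (1 / 2) = 1 := by
    rw [← map_add, add_halves, map_one]
  have hII : algebraMap ℂ Loc Complex.I * algebraMap ℂ Loc Complex.I = -1 := by
    rw [← map_mul, Complex.I_mul_I, map_neg, map_one]
  have hT := tEq_tInv
  rw [tEq, map_add] at hT
  fin_cases i <;> fin_cases j <;>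
    simp only [Fin.zero_eta, Fin.mk_one, proj, Matrix.cons_val_zero, Matrix.cons_val_one, map_mul,
      map_add, map_sub, map_one, psi_coord, psi_const, psiCoord, Matrix.cons_val, hI] at hT ⊢
  · linear_combination -algebraMap ℂ Loc (1 / 2) * hT +
      (algebraMap CoordRing Loc (x 0) * algebraMap CoordRing Loc (y 0) * tInv) * h2
  · linear_combination
      (algebraMap CoordRing Loc (x 0) * algebraMap CoordRing Loc (y 1) * tInv) * h2 +
      algebraMap ℂ Loc (1 / 2) * tInv * (algebraMap CoordRing Loc (x 1) *
        algebraMap CoordRing Loc (y 0) - algebraMap CoordRing Loc (x 0) *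
        algebraMap CoordRing Loc (y 1)) * hII
  · linear_combination
      (algebraMap CoordRing Loc (x 1) * algebraMap CoordRing Loc (y 0) * tInv) * h2 -
      algebraMap ℂ Loc (1 / 2) * tInv * (algebraMap CoordRing Loc (x 1) *
        algebraMap CoordRing Loc (y 0) - algebraMap CoordRing Loc (x 0) *
        algebraMap CoordRing Loc (y 1)) * hII
  · linear_combination -algebraMap ℂ Loc (1 / 2) * hT +
      (algebraMap CoordRing Loc (x 1) * algebraMap CoordRing Loc (y 1) * tInv) * h2

/-- The sphere coordinates are combinations of the `x_i y_j / T`. -/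
theorem coord_zero : coord 0 = proj 0 1 + proj 1 0 := by
  simp only [proj, Matrix.cons_val_zero, Matrix.cons_val_one]
  linear_combination -coord 0 * const_half

theorem coord_one : coord 1 = const Complex.I * (proj 1 0 - proj 0 1) := by
  simp only [proj, Matrix.cons_val_zero, Matrix.cons_val_one]
  linear_combination -coord 1 * const_half + 2 * const (1 / 2) * coord 1 * const_I

theorem coord_two : coord 2 = proj 0 0 - proj 1 1 := by
  simp only [proj, Matrix.cons_val_zero, Matrix.cons_val_one]
  linear_combination -coord 2 * const_half

section Injective

variable (j : Fin 2)

/-- The evaluation at the point `([p_{0j} : p_{1j}], [p_{j0} : p_{j1}])` of `ℙ¹ × ℙ¹` with values in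
the functions on `{p_{jj} ≠ 0}`. -/
def chartEval : CoordRing →+* Localization.Away (proj j j) :=
  eval₂Hom ((algebraMap ComplexSphereRing _).comp const)
    (Sum.elim (fun i => algebraMap _ _ (proj i j) * IsLocalization.Away.invSelf (proj j j))
      (fun i => algebraMap _ _ (proj j i)))

/-- This is the rank one relation `p_ij p_jk = p_ik p_jj` divided by `p_jj`. It makes `T` evaluate
to the trace of `proj`, which is 1. -/
theorem chartEval_xy (i k : Fin 2) :
    chartEval j (x i * y k) = algebraMap _ _ (proj i k) := by
  have h := IsLocalization.Away.mul_invSelf (S := Localization.Away (proj j j)) (proj j j)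
  have h' := congrArg (algebraMap ComplexSphereRing (Localization.Away (proj j j)))
    (proj_mul_proj i j j k)
  rw [map_mul, map_mul] at h'
  simp only [chartEval, x, y, map_mul, eval₂Hom_X', Sum.elim_inl, Sum.elim_inr]
  linear_combination IsLocalization.Away.invSelf (proj j j) * h' +
    algebraMap _ _ (proj i k) * h

theorem chartEval_tEq : chartEval j tEq = 1 := by
  rw [tEq, map_add, chartEval_xy, chartEval_xy, ← map_add, proj_trace, map_one]

/-- The extension of `chartEval` to `ℂ[x₀, x₁, y₀, y₁]_T`. -/
def chartLift : Loc →+* Localization.Away (proj j j) :=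
  IsLocalization.Away.lift tEq (g := chartEval j) (by rw [chartEval_tEq]; exact isUnit_one)

theorem chartLift_algebraMap (p : CoordRing) :
    chartLift j (algebraMap CoordRing Loc p) = chartEval j p :=
  IsLocalization.Away.lift_eq _ _ _

theorem chartLift_tInv : chartLift j tInv = 1 := by
  have h := congrArg (chartLift j) tEq_tInv
  rwa [map_mul, chartLift_algebraMap, chartEval_tEq, one_mul, map_one] at h

/-- So `psi` has a left inverse after inverting `p_jj`. It suffices to test constants and the
`p_ij`, since the coordinates are linear combinations of the latter. -/
theorem chartLift_psi (b : ComplexSphereRing) : chartLift j (psi b) = algebraMap _ _ b := by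
  suffices h : (chartLift j).comp psi.toRingHom = algebraMap _ _ from RingHom.congr_fun h b
  have hc : ∀ c, chartLift j (psi (const c)) = algebraMap _ _ (const c) := fun c => by
    rw [psi_const]
    exact (chartLift_algebraMap j (C c)).trans (eval₂Hom_C _ _ _)
  have hp : ∀ i k, chartLift j (psi (proj i k)) = algebraMap _ _ (proj i k) := fun i k => by
    rw [psi_proj, map_mul, chartLift_algebraMap, chartEval_xy, chartLift_tInv, mul_one]
  refine ringHom_ext hc fun i => ?_
  change chartLift j (psi (coord i)) = _
  fin_cases i
  · simp only [Fin.zero_eta, coord_zero, map_add, hp]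
  · simp only [Fin.mk_one, coord_one, map_mul, map_sub, hp, hc]
  · simp only [Fin.reduceFinMk, coord_two, map_sub, hp]

/-- The open sets `p₀₀ ≠ 0` and `p₁₁ ≠ 0` cover the sphere: an element of the kernel is killed by a
power of each, and these powers are coprime. -/
theorem psi_injective : Function.Injective psi := by
  rw [injective_iff_map_eq_zero]
  intro b hb
  have h : ∀ j, ∃ k, proj j j ^ k * b = 0 := fun j => by
    have h0 : algebraMap _ (Localization.Away (proj j j)) b = 0 := by
      rw [← chartLift_psi, hb, map_zero]
    obtain ⟨⟨_, k, rfl⟩, hk⟩ :=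
      (IsLocalization.map_eq_zero_iff (Submonoid.powers (proj j j)) _ b).mp h0
    exact ⟨k, hk⟩
  obtain ⟨k, hk⟩ := h 0
  obtain ⟨l, hl⟩ := h 1
  have hcop : IsCoprime (proj 0 0) (proj 1 1) := ⟨1, 1, by rw [one_mul, one_mul, proj_trace]⟩
  obtain ⟨u, v, huv⟩ := hcop.pow (m := k) (n := l)
  linear_combination -b * huv + u * hk + v * hl

end Injective

theorem weight_bideg (s : Fin 2 ⊕ Fin 2 →₀ ℕ) : Finsupp.weight bideg s =
    (s (Sum.inl 0) + s (Sum.inl 1), s (Sum.inr 0) + s (Sum.inr 1)) := by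
  rw [Finsupp.weight_apply, Finsupp.sum_fintype _ _ (by simp)]
  ext <;> simp [bideg, Fintype.sum_sum_type]

/-- A monomial of bidegree `(k, k)` is a product of `k` factors `x_i y_j`, and each factor absorbs
one `T⁻¹` to become `p_ij`. -/
theorem exists_psi_monomial (k : ℕ) (s : Fin 2 ⊕ Fin 2 →₀ ℕ)
    (hs : Finsupp.weight bideg s = (k, k)) :
    ∃ b, psi b = algebraMap CoordRing Loc (monomial s 1) * tInv ^ k := by
  rw [weight_bideg, Prod.mk.injEq] at hs
  induction k generalizing s with
  | zero =>
    have : s = 0 := by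
      ext (i | i) <;> fin_cases i <;> simp <;> omega
    subst this
    exact ⟨1, by simp⟩
  | succ k ih =>
    obtain ⟨i, hi⟩ : ∃ i, s (Sum.inl i) ≠ 0 := by
      by_contra! h
      have h0 := h 0
      have h1 := h 1
      omega
    obtain ⟨j, hj⟩ : ∃ j, s (Sum.inr j) ≠ 0 := by
      by_contra! h
      have h0 := h 0
      have h1 := h 1
      omega
    obtain ⟨s', rfl⟩ : ∃ s', s = Finsupp.single (Sum.inl i) 1 +
        (Finsupp.single (Sum.inr j) 1 + s') := by
      refine ⟨s - (Finsupp.single (Sum.inl i) 1 + Finsupp.single (Sum.inr j) 1), ?_⟩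
      rw [← add_assoc, add_tsub_cancel_of_le]
      intro t
      rcases t with t | t
      · by_cases h : t = i
        · subst h; simp; omega
        · simp [Ne.symm h]
      · by_cases h : t = j
        · subst h; simp; omega
        · simp [Ne.symm h]
    obtain ⟨b, hb⟩ := ih s' (by
      clear hi hj
      fin_cases i <;> fin_cases j <;> simp at hs <;> omega)
    refine ⟨proj i j * b, ?_⟩
    have hm : monomial (Finsupp.single (Sum.inl i) 1 + (Finsupp.single (Sum.inr j) 1 + s')) (1 : ℂ) =
        x i * y j * monomial s' 1 := by
      simp [x, y, X, monomial_mul, add_assoc]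
    rw [map_mul psi, hb, psi_proj, hm, map_mul _ (x i * y j), pow_succ]
    ring

/-- Every function on `{T ≠ 0}` comes from the sphere. -/
theorem exists_psi_eq {b : Loc} (hb : IsTwist 0 b) : ∃ c, psi c = b := by
  obtain ⟨k, p, hp, rfl⟩ := hb
  rw [zero_add] at hp
  rw [p.as_sum, map_sum, Finset.sum_mul]
  suffices h : ∀ s ∈ p.support, ∃ c, psi c =
      algebraMap CoordRing Loc (monomial s (p.coeff s)) * tInv ^ k by
    choose! c hc using h
    exact ⟨∑ s ∈ p.support, c s, by rw [map_sum]; exact Finset.sum_congr rfl hc⟩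
  intro s hs
  obtain ⟨b, hb⟩ := exists_psi_monomial k s (hp (mem_support_iff.mp hs))
  refine ⟨const (p.coeff s) * b, ?_⟩
  have hm : monomial s (p.coeff s) = C (p.coeff s) * monomial s (1 : ℂ) := by
    rw [C_mul_monomial, mul_one]
  rw [map_mul, hb, psi_const, hm, map_mul, mul_assoc]
  rfl

end BiProj
end

/-! ### Functors of points of linear schemes and their complexifications -/

noncomputable section

namespace LinearScheme

/-- By the Yoneda lemma, natural linear bijections between the sections of two linear schemes come
from an isomorphism. -/
theorem nonempty_iso_of_sections {S : Scheme.{0}} (E F : LinearScheme S)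
    (e : ∀ {T : Scheme.{0}} (f : T ⟶ S), SectionsOver E.proj f ≃ₗ[Γ(T, ⊤)] SectionsOver F.proj f)
    (he : ∀ {T' T : Scheme.{0}} (h : T' ⟶ T) (f : T ⟶ S) (s : SectionsOver E.proj f),
      e (h ≫ f) (s.restrict h) = (e f s).restrict h) : Nonempty (Iso E F) := by
  -- The tautological sections: every section is the restriction of one of these along itself, so
  -- naturality turns `e` and its inverse into composition with fixed morphisms.
  let u : SectionsOver E.proj E.proj := ⟨𝟙 _, Category.id_comp _⟩
  let v : SectionsOver F.proj F.proj := ⟨𝟙 _, Category.id_comp _⟩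
  have hu : ∀ {T : Scheme.{0}} (f : T ⟶ S) (s : SectionsOver E.proj f),
      (e f s).hom = s.hom ≫ (e E.proj u).hom := by
    rintro T _ ⟨s, rfl⟩
    rw [← show SectionsOver.restrict s u = ⟨s, rfl⟩ from
      SectionsOver.ext (Category.comp_id _), he]
    exact congrArg (· ≫ (e E.proj u).hom) (Category.comp_id s).symm
  have hv : ∀ {T : Scheme.{0}} (f : T ⟶ S) (s : SectionsOver F.proj f),
      ((e f).symm s).hom = s.hom ≫ ((e F.proj).symm v).hom := by
    rintro T _ ⟨s, rfl⟩
    rw [← show SectionsOver.restrict s v = ⟨s, rfl⟩ from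
      SectionsOver.ext (Category.comp_id _)]
    have h : (e (s ≫ F.proj)).symm (SectionsOver.restrict s v) =
        ((e F.proj).symm v).restrict s := by
      rw [LinearEquiv.symm_apply_eq, he, LinearEquiv.apply_symm_apply]
    rw [h]
    exact congrArg (· ≫ ((e F.proj).symm v).hom) (Category.comp_id s).symm
  have hmap : ∀ {T : Scheme.{0}} (f : T ⟶ S) (s : SectionsOver E.proj f),
      s.map (e E.proj u).hom (e E.proj u).comm = e f s :=
    fun f s => SectionsOver.ext (hu f s).symm
  refine ⟨⟨⟨(e E.proj u).hom, ((e F.proj).symm v).hom, ?_, ?_⟩, (e E.proj u).comm, ?_, ?_⟩⟩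
  · rw [← hv E.proj, LinearEquiv.symm_apply_apply]
  · rw [← hu F.proj, LinearEquiv.apply_symm_apply]
  · intro T f s t
    rw [hmap, hmap, hmap, _root_.map_add]
  · intro T f a s
    rw [hmap, hmap, _root_.map_smul]

/-- Sections of the trivial bundle are tuples of functions. -/
def trivialSections (r : ℕ) (S : Scheme.{0}) {T : Scheme.{0}} (f : T ⟶ S) :
    SectionsOver (trivial r S).proj f ≃ₗ[Γ(T, ⊤)] (Fin r → Γ(T, ⊤)) :=
  { trivialSectionsEquiv r S f with
    map_add' := fun _ _ => (trivialSectionsEquiv r S f).apply_symm_apply _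
    map_smul' := fun _ _ => (trivialSectionsEquiv r S f).apply_symm_apply _ }

theorem trivialSections_restrict (r : ℕ) {S T T' : Scheme.{0}} (h : T' ⟶ T) (f : T ⟶ S)
    (s : SectionsOver (trivial r S).proj f) (i : Fin r) :
    trivialSections r S (h ≫ f) (s.restrict h) i = h.appTop.hom (trivialSections r S f s i) := by
  change (h ≫ s.hom).appTop.hom _ = h.appTop.hom (s.hom.appTop.hom _)
  rw [Scheme.Hom.comp_appTop]; rfl

/-- Sections of `Spec (Sym N)` are semilinear maps from `N` to functions. -/
def specSymSections (R N : Type) [CommRing R] [AddCommGroup N] [Module R N]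
    {T : Scheme.{0}} (f : T ⟶ Spec (.of R)) :
    SectionsOver (specSym R N).proj f ≃ₗ[Γ(T, ⊤)] (N →ₛₗ[coeffHom f] Γ(T, ⊤)) :=
  { specSymSectionsEquiv R N f with
    map_add' := fun _ _ => (specSymSectionsEquiv R N f).apply_symm_apply _
    map_smul' := fun _ _ => (specSymSectionsEquiv R N f).apply_symm_apply _ }

/-- Sections of the complexification are sections of the original bundle. -/
def complexifySections {S : Scheme.{0}} (E : LinearScheme S) (π : S ⟶ Spec (.of ℝ))
    {T : Scheme.{0}} (f : T ⟶ complexification π) :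
    SectionsOver (E.complexify π).proj f ≃ₗ[Γ(T, ⊤)]
      SectionsOver E.proj (f ≫ complexificationFst π) :=
  { complexifySectionsEquiv E.proj π f with
    map_add' := fun _ _ => (complexifySectionsEquiv E.proj π f).apply_symm_apply _
    map_smul' := fun _ _ => (complexifySectionsEquiv E.proj π f).apply_symm_apply _ }

theorem complexifySections_restrict {S : Scheme.{0}} (E : LinearScheme S) (π : S ⟶ Spec (.of ℝ))
    {T T' : Scheme.{0}} (h : T' ⟶ T) (f : T ⟶ complexification π)
    (s : SectionsOver (E.complexify π).proj f) :
    complexifySections E π (h ≫ f) (s.restrict h) = (complexifySections E π f s).restrict h :=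
  SectionsOver.ext (Category.assoc _ _ _)

section Affine

variable (A : Type) [CommRing A] [Algebra ℝ A]

/-- The structure morphism of an affine real scheme. -/
abbrev specToSpecReal : Spec (.of A) ⟶ Spec (.of ℝ) :=
  Spec.map (CommRingCat.ofHom (algebraMap ℝ A))

/-- The ring homomorphism `A ⊗ ℂ → Γ(T, 𝒪_T)` of a morphism from `T` to the complexification of
`Spec A`. -/
def complexCoeffHom {T : Scheme.{0}} (f : T ⟶ complexification (specToSpecReal A)) :
    A ⊗[ℝ] ℂ →+* Γ(T, ⊤) :=
  letI := (coeffHom (f ≫ complexificationFst (specToSpecReal A) ≫ specToSpecReal A)).toAlgebra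
  (Algebra.TensorProduct.lift (R := ℝ) (S := ℝ) (C := Γ(T, ⊤))
    { coeffHom (f ≫ complexificationFst (specToSpecReal A)) with
      commutes' := fun r => by
        rw [RingHom.algebraMap_toAlgebra, ← Category.assoc, coeffHom_comp]; rfl }
    { coeffHom (f ≫ complexificationSnd (specToSpecReal A)) with
      commutes' := fun r => by
        change coeffHom _ (algebraMap ℝ ℂ r) = coeffHom _ r
        rw [complexification_condition, specComplexToReal, ← Category.assoc, coeffHom_comp]; rfl }
    (fun _ _ => Commute.all _ _)).toRingHom

theorem complexCoeffHom_tmul {T : Scheme.{0}} (f : T ⟶ complexification (specToSpecReal A))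
    (a : A) (z : ℂ) : complexCoeffHom A f (a ⊗ₜ z) =
      coeffHom (f ≫ complexificationFst (specToSpecReal A)) a *
        coeffHom (f ≫ complexificationSnd (specToSpecReal A)) z :=
  rfl

theorem complexCoeffHom_algebraMap {T : Scheme.{0}}
    (f : T ⟶ complexification (specToSpecReal A)) (a : A) :
    complexCoeffHom A f (algebraMap A _ a) =
      coeffHom (f ≫ complexificationFst (specToSpecReal A)) a := by
  rw [Algebra.TensorProduct.algebraMap_apply, complexCoeffHom_tmul, _root_.map_one, mul_one]; rfl

theorem complexCoeffHom_precomp {T T' : Scheme.{0}} (h : T' ⟶ T)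
    (f : T ⟶ complexification (specToSpecReal A)) (b : A ⊗[ℝ] ℂ) :
    complexCoeffHom A (h ≫ f) b = h.appTop.hom (complexCoeffHom A f b) := by
  induction b with
  | zero => simp only [_root_.map_zero]
  | add x y hx hy => simp only [_root_.map_add, hx, hy]
  | tmul a z =>
    rw [complexCoeffHom_tmul, complexCoeffHom_tmul, _root_.map_mul, Category.assoc, Category.assoc,
      coeffHom_precomp, coeffHom_precomp]
    rfl

variable {A} {N : Type} [AddCommGroup N] [Module A N]

/-- Semilinear extension of a map `N → G` to the base change of `N`. -/
def semilinearLift {B G : Type} [CommRing B] [Algebra A B] [CommRing G] {φ : A →+* G}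
    (β : B →+* G) (hβ : ∀ a, β (algebraMap A B a) = φ a) :
    (N →ₛₗ[φ] G) ≃ₗ[G] (B ⊗[A] N →ₛₗ[β] G) :=
  letI := β.toAlgebra
  letI := φ.toAlgebra
  haveI : IsScalarTower A B G := IsScalarTower.of_algebraMap_eq fun a => (hβ a).symm
  { toFun := fun l =>
      let l' : N →ₗ[A] G :=
        { toFun := l
          map_add' := l.map_add
          map_smul' := fun c x => by
            rw [LinearMap.map_smulₛₗ, RingHom.id_apply, Algebra.smul_def]; rfl }
      { toFun := LinearMap.liftBaseChange B l'
        map_add' := LinearMap.map_add _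
        map_smul' := fun c x => by rw [_root_.map_smul, Algebra.smul_def]; rfl }
    map_add' := fun l m => by
      ext x
      induction x with
      | zero => simp
      | add x y hx hy => rw [_root_.map_add, hx, hy, _root_.map_add]
      | tmul b n => simp [mul_add, Algebra.smul_def]
    map_smul' := fun g l => by
      ext x
      induction x with
      | zero => simp
      | add x y hx hy => rw [_root_.map_add, hx, hy, _root_.map_add]
      | tmul b n => simp [Algebra.smul_def]; ring
    invFun := fun l =>
      { toFun := fun n => l (1 ⊗ₜ n)
        map_add' := fun x y => by rw [tmul_add, _root_.map_add]
        map_smul' := fun c x => by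
          rw [tmul_smul, ← algebraMap_smul B c, LinearMap.map_smulₛₗ, hβ] }
    left_inv := fun l => by ext n; simp
    right_inv := fun l => by
      ext x
      induction x with
      | zero => simp
      | add x y hx hy => rw [_root_.map_add, hx, hy, _root_.map_add]
      | tmul b n =>
        have h := l.map_smulₛₗ b (1 ⊗ₜ n)
        rw [smul_tmul', smul_eq_mul, mul_one] at h
        rw [h]
        simp [Algebra.smul_def]; rfl }

omit [Algebra ℝ A] in
theorem semilinearLift_tmul {B G : Type} [CommRing B] [Algebra A B] [CommRing G] {φ : A →+* G}
    (β : B →+* G) (hβ : ∀ a, β (algebraMap A B a) = φ a) (l : N →ₛₗ[φ] G) (b : B) (n : N) :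
    semilinearLift β hβ l (b ⊗ₜ n) = β b * l n :=
  rfl

/-- Semilinear maps from `R^r` to an `R`-algebra are `r`-tuples. -/
def semilinearPi {r : ℕ} {B M G : Type} [CommRing B] [AddCommMonoid M] [Module B M] [CommRing G]
    (β : B →+* G) (e : M ≃ₗ[B] (Fin r → B)) : (M →ₛₗ[β] G) ≃ₗ[G] (Fin r → G) where
  toFun l i := l (e.symm (Pi.single i 1))
  map_add' _ _ := rfl
  map_smul' _ _ := rfl
  invFun v :=
    { toFun := fun m => ∑ i, β (e m i) * v i
      map_add' := fun x y => by simp [add_mul, Finset.sum_add_distrib]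
      map_smul' := fun c x => by simp [mul_assoc, Finset.mul_sum] }
  left_inv l := by
    ext m
    obtain ⟨w, rfl⟩ := e.symm.surjective m
    change ∑ i, β (e (e.symm w) i) * l (e.symm (Pi.single i 1)) = _
    rw [e.apply_symm_apply]
    conv_rhs => rw [pi_eq_sum_univ' w, _root_.map_sum, _root_.map_sum]
    refine Finset.sum_congr rfl fun i _ => ?_
    rw [_root_.map_smul, LinearMap.map_smulₛₗ, smul_eq_mul]
  right_inv v := by
    funext i
    change ∑ j, β (e (e.symm (Pi.single i 1)) j) * v j = v i
    simp [Pi.single_apply]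

theorem semilinearPi_apply {r : ℕ} {B M G : Type} [CommRing B] [AddCommMonoid M] [Module B M]
    [CommRing G] (β : B →+* G) (e : M ≃ₗ[B] (Fin r → B)) (l : M →ₛₗ[β] G) (i : Fin r) :
    semilinearPi β e l i = l (e.symm (Pi.single i 1)) :=
  rfl

variable (N) in
/-- If the complexification of `N` is free, then the bundle `Spec (Sym N)` has trivial
complexification. -/
theorem nonempty_iso_complexify_specSym {r : ℕ}
    (e : (A ⊗[ℝ] ℂ) ⊗[A] N ≃ₗ[A ⊗[ℝ] ℂ] (Fin r → A ⊗[ℝ] ℂ)) :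
    Nonempty (Iso ((specSym A N).complexify (specToSpecReal A))
      (trivial r (complexification (specToSpecReal A)))) := by
  -- A section over `T ⟶ S_ℂ` is in turn a section of the real bundle, a semilinear map on `N`, its
  -- extension to the complexification of `N`, and the tuple of values on the basis given by `e`.
  refine nonempty_iso_of_sections _ _ (fun {T} f =>
    complexifySections _ _ f ≪≫ₗ specSymSections A N _ ≪≫ₗ
      semilinearLift (complexCoeffHom A f) (complexCoeffHom_algebraMap A f) ≪≫ₗ
        semilinearPi (complexCoeffHom A f) e ≪≫ₗ (trivialSections r _ f).symm) ?_
  intro T' T h f s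
  apply (trivialSections r _ (h ≫ f)).injective
  funext i
  rw [trivialSections_restrict]
  simp only [LinearEquiv.trans_apply, LinearEquiv.apply_symm_apply]
  rw [complexifySections_restrict]
  generalize complexifySections (specSym A N) (specToSpecReal A) f s = s'
  rw [semilinearPi_apply, semilinearPi_apply]
  -- Both sides are additive in the basis vector, so naturality need only be checked on pure
  -- tensors.
  generalize e.symm (Pi.single i 1) = z
  induction z with
  | zero => simp only [_root_.map_zero]
  | add x y hx hy => rw [_root_.map_add, _root_.map_add, _root_.map_add, hx, hy]
  | tmul b n =>
    rw [semilinearLift_tmul, semilinearLift_tmul, _root_.map_mul, complexCoeffHom_precomp]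
    congr 1

end Affine

end LinearScheme
end

/-! ### The real structure in bihomogeneous coordinates and the frame of `L_n ⊕ σ^*L_n` -/

noncomputable section

namespace BiProj

open MvPolynomial

/-- The homogeneous elements of bidegree `(m, n)` of `ℂ[x₀, x₁, y₀, y₁]_T`. -/
def IsBihomogeneous (m n : ℕ) (b : Loc) : Prop :=
  ∃ (k : ℕ) (p : CoordRing), p.IsWeightedHomogeneous bideg (m + k, n + k) ∧
    b = algebraMap CoordRing Loc p * tInv ^ k

theorem isBihomogeneous_zero_iff {n : ℕ} {b : Loc} : IsBihomogeneous n 0 b ↔ IsTwist n b := by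
  simp only [IsBihomogeneous, IsTwist, zero_add]

theorem IsBihomogeneous.mul {m n m' n' : ℕ} {a b : Loc} (ha : IsBihomogeneous m n a)
    (hb : IsBihomogeneous m' n' b) : IsBihomogeneous (m + m') (n + n') (a * b) := by
  obtain ⟨k, p, hp, rfl⟩ := ha
  obtain ⟨l, q, hq, rfl⟩ := hb
  refine ⟨k + l, p * q, ?_, by rw [map_mul, pow_add]; ring⟩
  convert hp.mul hq using 1
  ext <;> simp <;> ring

/-- The pairing of `𝒪(n, 0)` with `𝒪(0, n)`: the product lies in `𝒪(n, n)`, which `Tⁿ` trivializes.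
-/
theorem IsTwist.mul_tInv_pow {n : ℕ} {a b : Loc} (ha : IsTwist n a) (hb : IsBihomogeneous 0 n b) :
    IsTwist 0 (a * b * tInv ^ n) := by
  obtain ⟨k, p, hp, h⟩ := (isBihomogeneous_zero_iff.mpr ha).mul hb
  refine ⟨k + n, p, ?_, by rw [h, pow_add, mul_assoc]⟩
  convert hp using 1
  ext <;> simp <;> ring

theorem isTwist_x_pow (i : Fin 2) (n : ℕ) : IsTwist n (algebraMap CoordRing Loc (x i ^ n)) :=
  ⟨0, x i ^ n, by
    have h := (isWeightedHomogeneous_X ℂ bideg (Sum.inl i)).pow n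
    rwa [show n • bideg (Sum.inl i) = (n + 0, 0) by simp [bideg]] at h,
    by rw [pow_zero, mul_one]⟩

/-- Complex conjugation of the coefficients composed with the exchange of the `xᵢ` and the `yᵢ`. -/
def swapConj : CoordRing →+* CoordRing :=
  (rename Sum.swap : CoordRing →ₐ[ℂ] CoordRing).toRingHom.comp (map (starRingEnd ℂ))

theorem swapConj_C (c : ℂ) : swapConj (C c) = C (starRingEnd ℂ c) := by simp [swapConj]

theorem swapConj_x (i : Fin 2) : swapConj (x i) = y i := by simp [swapConj, x, y]

theorem swapConj_y (i : Fin 2) : swapConj (y i) = x i := by simp [swapConj, x, y]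

theorem swapConj_swapConj (p : CoordRing) : swapConj (swapConj p) = p := by
  suffices h : swapConj.comp swapConj = RingHom.id _ from RingHom.congr_fun h p
  refine MvPolynomial.ringHom_ext (fun c => ?_) (fun i => ?_)
  · simp [swapConj_C]
  · rcases i with i | i
    · exact (congrArg swapConj (swapConj_x i)).trans (swapConj_y i)
    · exact (congrArg swapConj (swapConj_y i)).trans (swapConj_x i)

theorem swapConj_tEq : swapConj tEq = tEq := by
  simp only [tEq, map_add, map_mul, swapConj_x, swapConj_y, mul_comm]

theorem isWeightedHomogeneous_swapConj {p : CoordRing} {m n : ℕ}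
    (hp : p.IsWeightedHomogeneous bideg (m, n)) :
    (swapConj p).IsWeightedHomogeneous bideg (n, m) := by
  intro d hd
  obtain ⟨u, rfl, hu⟩ := coeff_rename_ne_zero _ _ _ hd
  have hu' : coeff u p ≠ 0 := fun h => hu (by rw [coeff_map, h, map_zero])
  have h := hp hu'
  have hs : ∀ i, Finsupp.mapDomain Sum.swap u i = u i.swap := fun i => by
    conv_lhs => rw [← Sum.swap_swap i]
    exact Finsupp.mapDomain_apply (Equiv.sumComm _ _).injective _ _
  rw [weight_bideg, Prod.mk.injEq] at h ⊢
  simp only [hs, Sum.swap_inl, Sum.swap_inr]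
  exact h.symm

/-- The extension of `swapConj` to `ℂ[x₀, x₁, y₀, y₁]_T`: the real structure of the quadric. -/
def conjLoc : Loc →+* Loc :=
  IsLocalization.Away.lift tEq (g := (algebraMap CoordRing Loc).comp swapConj) (by
    rw [RingHom.comp_apply, swapConj_tEq]
    exact IsLocalization.Away.algebraMap_isUnit tEq)

theorem conjLoc_algebraMap (p : CoordRing) :
    conjLoc (algebraMap CoordRing Loc p) = algebraMap CoordRing Loc (swapConj p) :=
  IsLocalization.Away.lift_eq _ _ _

theorem conjLoc_tInv : conjLoc tInv = tInv := by
  have h := congrArg conjLoc tEq_tInv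
  rw [map_mul, conjLoc_algebraMap, swapConj_tEq, map_one] at h
  linear_combination tInv * h - conjLoc tInv * tEq_tInv

theorem conjLoc_conjLoc (b : Loc) : conjLoc (conjLoc b) = b := by
  suffices h : conjLoc.comp conjLoc = RingHom.id Loc from RingHom.congr_fun h b
  refine IsLocalization.ringHom_ext (Submonoid.powers tEq) (RingHom.ext fun p => ?_)
  simp [conjLoc_algebraMap, swapConj_swapConj]

theorem isBihomogeneous_conjLoc {m n : ℕ} {b : Loc} (hb : IsBihomogeneous m n b) :
    IsBihomogeneous n m (conjLoc b) := by
  obtain ⟨k, p, hp, rfl⟩ := hb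
  exact ⟨k, swapConj p, isWeightedHomogeneous_swapConj hp, by
    rw [map_mul, map_pow, conjLoc_tInv, conjLoc_algebraMap]⟩

/-- Under `ψ`, the conjugation `σ` becomes `(x, y) ↦ (ȳ, x̄)`. This is what places `σ^*L_n` in
bidegree `(0, n)`. -/
theorem conjLoc_psi (b : ComplexSphereRing) : conjLoc (psi b) = psi (conjHom SphereRing b) := by
  suffices h : conjLoc.comp psi.toRingHom = psi.toRingHom.comp (conjHom SphereRing).toRingHom from
    RingHom.congr_fun h b
  refine ringHom_ext (fun c => ?_) (fun i => ?_)
  · have h : conjHom SphereRing (const c) = const (starRingEnd ℂ c) :=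
      Algebra.TensorProduct.map_tmul _ _ _ _
    change conjLoc (psi (const c)) = psi (conjHom SphereRing (const c))
    rw [h, psi_const, psi_const]
    exact (conjLoc_algebraMap (C c)).trans (by rw [swapConj_C]; rfl)
  · have h : conjHom SphereRing (coord i) = coord i :=
      (Algebra.TensorProduct.map_tmul _ _ _ _).trans (by rw [map_one]; rfl)
    change conjLoc (psi (coord i)) = psi (conjHom SphereRing (coord i))
    rw [h, psi_coord]
    fin_cases i
    · simp only [psiCoord, Fin.zero_eta, Matrix.cons_val_zero, map_mul, conjLoc_tInv, map_add,
        conjLoc_algebraMap, swapConj_x, swapConj_y]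
      ring
    -- The swap negates `x₁y₀ - x₀y₁` and conjugation negates `i`, so the signs cancel.
    · simp only [psiCoord, Fin.mk_one, Matrix.cons_val_one, Matrix.cons_val_zero, map_mul,
        conjLoc_tInv, map_sub, conjLoc_algebraMap, swapConj_x, swapConj_y, swapConj_C, map_neg,
        Complex.conj_I]
      ring
    · simp only [psiCoord, Fin.reduceFinMk, Matrix.cons_val, map_mul, conjLoc_tInv, map_sub,
        conjLoc_algebraMap, swapConj_x, swapConj_y]
      ring

variable (n : ℕ)

/-- The section `xᵢⁿ` of `L_n`. -/
def xPow (i : Fin 2) : lineBundle n := ⟨algebraMap CoordRing Loc (x i ^ n), isTwist_x_pow i n⟩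

/-- The identification of `σ^*L_n` with the homogeneous elements of bidegree `(0, n)`. -/
def conjVal : ConjPullback (lineBundle n) →ₗ[ComplexSphereRing] Loc where
  toFun l := conjLoc (show lineBundle n from l).1
  map_add' l m := map_add conjLoc _ _
  map_smul' c l := by
    change conjLoc (psi (conjHom SphereRing c) * _) = psi c * _
    rw [map_mul, conjLoc_psi, conjHom_conjHom]

theorem conjVal_injective : Function.Injective (conjVal n) := fun l m h => by
  have h' := congrArg conjLoc h
  change conjLoc (conjLoc _) = conjLoc (conjLoc _) at h'
  rw [conjLoc_conjLoc, conjLoc_conjLoc] at h'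
  exact Subtype.ext h'

theorem isBihomogeneous_conjVal (l : ConjPullback (lineBundle n)) :
    IsBihomogeneous 0 n (conjVal n l) :=
  isBihomogeneous_conjLoc (isBihomogeneous_zero_iff.mpr (show lineBundle n from l).2)

/-- The section `xᵢⁿ` of `σ^*L_n`. -/
def xPowConj (i : Fin 2) : ConjPullback (lineBundle n) := xPow n i

theorem conjVal_xPowConj (i : Fin 2) :
    conjVal n (xPowConj n i) = algebraMap CoordRing Loc (y i ^ n) := by
  change conjLoc (algebraMap CoordRing Loc (x i ^ n)) = _
  rw [conjLoc_algebraMap, map_pow, swapConj_x]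

theorem smul_eq (c : ComplexSphereRing) (b : Loc) : c • b = psi c * b := rfl

/-- The bundle `L_n ⊕ σ^*L_n` on the complexified sphere is trivial. -/
theorem nonempty_lineBundle_prod_equiv :
    Nonempty ((lineBundle n × ConjPullback (lineBundle n)) ≃ₗ[ComplexSphereRing]
      (Fin 2 → ComplexSphereRing)) := by
  have hcop : IsCoprime (proj 0 0) (proj 1 1) := ⟨1, 1, by rw [one_mul, one_mul, proj_trace]⟩
  obtain ⟨a₀, a₁, ha⟩ := hcop.pow (m := n) (n := n)
  let u := conjVal n (a₀ • xPowConj n 0)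
  let v := conjVal n (a₁ • xPowConj n 1)
  let p : Loc := (xPow n 0).1
  let q : Loc := (xPow n 1).1
  -- The Bézout identity for `p₀₀ⁿ` and `p₁₁ⁿ`, read as: the matrix with rows `(p, -v)` and `(q, u)`
  -- has determinant `Tⁿ`.
  have hD : (p * u + q * v) * tInv ^ n = 1 := by
    have h := congrArg psi ha
    simp only [map_add, map_mul, map_pow, psi_proj, map_one, mul_pow] at h
    simp only [p, q, u, v, xPow, map_smul, conjVal_xPowConj, smul_eq, map_pow]
    linear_combination h
  let g : (Fin 2 → ComplexSphereRing) →ₗ[ComplexSphereRing]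
      lineBundle n × ConjPullback (lineBundle n) :=
    Fintype.linearCombination ComplexSphereRing
      ![(xPow n 0, -(a₁ • xPowConj n 1)), (xPow n 1, a₀ • xPowConj n 0)]
  have hg : ∀ c, g c = c 0 • (xPow n 0, -(a₁ • xPowConj n 1)) +
      c 1 • (xPow n 1, a₀ • xPowConj n 0) := fun c => by
    simp only [g, Fintype.linearCombination_apply, Fin.sum_univ_two, Matrix.cons_val_zero,
      Matrix.cons_val_one]
  have hg1 : ∀ c, ((g c).1 : Loc) = psi (c 0) * p + psi (c 1) * q := fun c => by
    rw [hg]; rfl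
  have hg2 : ∀ c, conjVal n (g c).2 = -psi (c 0) * v + psi (c 1) * u := fun c => by
    have h : (g c).2 = c 0 • -(a₁ • xPowConj n 1) + c 1 • a₀ • xPowConj n 0 := by rw [hg]; rfl
    rw [h, map_add, map_smul, map_smul, map_neg, smul_eq, smul_eq]
    ring
  refine ⟨(LinearEquiv.ofBijective g ⟨?_, ?_⟩).symm⟩
  · rw [injective_iff_map_eq_zero]
    intro c hc
    have h1 := hg1 c
    have h2 := hg2 c
    rw [hc] at h1 h2
    rw [show ((0 : lineBundle n × ConjPullback (lineBundle n)).2) = 0 from rfl, map_zero] at h2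
    rw [show (((0 : lineBundle n × ConjPullback (lineBundle n)).1 : lineBundle n) : Loc) = 0
      from rfl] at h1
    funext i
    apply psi_injective
    rw [Pi.zero_apply, map_zero]
    fin_cases i
    · change psi (c 0) = 0
      -- Multiplication by the adjugate matrix over `Tⁿ`.
      linear_combination -psi (c 0) * hD - u * tInv ^ n * h1 + q * tInv ^ n * h2
    · change psi (c 1) = 0
      linear_combination -psi (c 1) * hD - v * tInv ^ n * h1 - p * tInv ^ n * h2
  · rintro ⟨l, l'⟩
    have hu : IsBihomogeneous 0 n u := isBihomogeneous_conjVal n _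
    have hv : IsBihomogeneous 0 n v := isBihomogeneous_conjVal n _
    have hm := isBihomogeneous_conjVal n l'
    have hneg : ∀ {b}, IsTwist 0 b → IsTwist 0 (-b) := fun {b} hb => by
      have h := (isTwist_C (-1)).mul hb
      rwa [map_neg, map_one, neg_one_mul] at h
    -- Cramer's rule: with `m` the image of `l'` in bidegree `(0, n)`, the coefficients are `(lu -
    -- qm)/Tⁿ` and `(lv + pm)/Tⁿ`, both of bidegree `(0, 0)`.
    obtain ⟨c, hc⟩ := exists_psi_eq
      ((l.2.mul_tInv_pow hu).add (hneg ((xPow n 1).2.mul_tInv_pow hm)))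
    obtain ⟨d, hd⟩ := exists_psi_eq ((l.2.mul_tInv_pow hv).add ((xPow n 0).2.mul_tInv_pow hm))
    refine ⟨![c, d], Prod.ext (Subtype.ext ?_) (conjVal_injective n ?_)⟩
    · rw [hg1]
      change psi c * p + psi d * q = l.1
      rw [hc, hd]
      linear_combination (l : Loc) * hD
    · rw [hg2]
      change -psi c * v + psi d * u = conjVal n l'
      rw [hc, hd]
      linear_combination conjVal n l' * hD

end BiProj

end

theorem mainTheorem6 (n : ℕ) :
    Nonempty (LinearScheme.Iso
      ((sphereBundle n).complexify sphereToSpecReal)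
      (LinearScheme.trivial 2 (complexification sphereToSpecReal))) := by
  obtain ⟨e⟩ := BiProj.nonempty_lineBundle_prod_equiv n
  -- Here `N` is the dual of the descended module, so the frame `e` has to be transported to the
  -- dual.
  exact LinearScheme.nonempty_iso_complexify_specSym _
    (baseChangeDualEquivPi (descendedBaseChangeEquiv SphereRing (BiProj.lineBundle n) ≪≫ₗ e))
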